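/- Let $n \ge d$, let $\Sigma \in \mathbb{R}^{d \times d}$ be a fixed (symmetric) positive definite matrix, and let $\mathcal{W}_n(\Sigma, d)$ denote the Wishart distribution, i.e. the distribution of $\sum_{i=1}^n X_i X_i^\top$ where $X_1, \dots, X_n$ are i.i.d. samples from the Gaussian distribution $\mathcal{N}(0, \Sigma)$ on $\mathbb{R}^d$. Let $\Sigma_e \sim \mathcal{W}_n(\Sigma, d)$, and let $R \in \mathbb{R}^{d \times n}$ be the matrix consisting of the first $d$ rows of an $n \times n$ random matrix that is independent of $\Sigma_e$ and distributed according to the Haar probability measure on the orthogonal group $\mathcal{O}_n$. Let $\Sigma_e^{1/2}$ be the positive semidefinite square root of $\Sigma_e$, and let $Y_1, \dots, Y_n$ be the $n$ columns of $\Sigma_e^{1/2} R$. Then $Y_1, \dots, Y_n$ are independent and each has distribution $\mathcal{N}(0, \Sigma)$. -/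

import Mathlib

open MeasureTheory ProbabilityTheory Matrix
open scoped MatrixOrder

/-- Real matrices carry the entrywise (product) `σ`-algebra. -/
instance instMeasurableSpaceRealMatrix {d n : ℕ} :
    MeasurableSpace (Matrix (Fin d) (Fin n) ℝ) :=
  inferInstanceAs (MeasurableSpace (Fin d → Fin n → ℝ))

/-- The product `σ`-algebra on real matrices is the Borel `σ`-algebra. -/
instance instBorelSpaceRealMatrix {d n : ℕ} : BorelSpace (Matrix (Fin d) (Fin n) ℝ) :=
  inferInstanceAs (BorelSpace (Fin d → Fin n → ℝ))

/-- The orthogonal group `O_n` is compact. -/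
instance instCompactSpaceRealOrthogonal (n : ℕ) :
    CompactSpace (Matrix.orthogonalGroup (Fin n) ℝ) := by
  refine isCompact_iff_compactSpace.mp ?_
  have hK : IsCompact (Set.univ.pi fun _ : Fin n => Set.univ.pi fun _ : Fin n =>
      Set.Icc (-1 : ℝ) 1) :=
    isCompact_univ_pi fun _ => isCompact_univ_pi fun _ => isCompact_Icc
  have hcl : IsClosed (Matrix.orthogonalGroup (Fin n) ℝ : Set (Matrix (Fin n) (Fin n) ℝ)) :=
    isClosed_unitary
  refine IsCompact.of_isClosed_subset (X := Matrix (Fin n) (Fin n) ℝ) hK hcl ?_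
  intro U hU i _ j _
  have h := entry_norm_bound_of_unitary hU i j
  rw [Real.norm_eq_abs, abs_le] at h
  exact ⟨h.1, h.2⟩

/-- The Haar probability measure on the orthogonal group `O_n`: the Haar measure which gives
mass one to the whole (compact) group. -/
noncomputable def haarOrthogonal (n : ℕ) : Measure (Matrix.orthogonalGroup (Fin n) ℝ) :=
  Measure.haarMeasure ⊤

instance instIsProbabilityMeasureHaarOrthogonal (n : ℕ) :
    IsProbabilityMeasure (haarOrthogonal n) :=
  ⟨Measure.haarMeasure_self (K₀ := (⊤ : TopologicalSpace.PositiveCompacts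
    (Matrix.orthogonalGroup (Fin n) ℝ)))⟩

instance instIsHaarMeasureHaarOrthogonal (n : ℕ) : (haarOrthogonal n).IsHaarMeasure :=
  inferInstanceAs (Measure.haarMeasure _).IsHaarMeasure

/-- The scatter matrix `∑ i, x i * (x i)ᵀ` of the vectors `x 0, …, x (n - 1)` of `ℝ^d`. -/
noncomputable def scatterMatrix {n d : ℕ} (x : Fin n → EuclideanSpace ℝ (Fin d)) :
    Matrix (Fin d) (Fin d) ℝ :=
  ∑ i, Matrix.vecMulVec (x i) (x i)

theorem measurable_scatterMatrix {n d : ℕ} :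
    Measurable (scatterMatrix : (Fin n → EuclideanSpace ℝ (Fin d)) → _) := by
  refine measurable_pi_lambda _ fun a => measurable_pi_lambda _ fun b => ?_
  simp only [scatterMatrix, Matrix.sum_apply, Matrix.vecMulVec_apply]
  fun_prop

/-- The Wishart distribution `W_n(S, d)`: the law of `∑ i, X i * (X i)ᵀ` for
`X 0, …, X (n - 1)` i.i.d. samples from `N(0, S)`. -/
noncomputable def wishart (n : ℕ) {d : ℕ} (S : Matrix (Fin d) (Fin d) ℝ) :
    Measure (Matrix (Fin d) (Fin d) ℝ) :=
  (Measure.pi fun _ : Fin n => multivariateGaussian (0 : EuclideanSpace ℝ (Fin d)) S).map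
    scatterMatrix

instance instIsProbabilityMeasureWishart (n : ℕ) {d : ℕ} (S : Matrix (Fin d) (Fin d) ℝ) :
    IsProbabilityMeasure (wishart n S) :=
  Measure.isProbabilityMeasure_map measurable_scatterMatrix.aemeasurable

/-- The `d × n` matrix formed by the first `d` rows of an `n × n` matrix, for `d ≤ n`. -/
def firstRows {d n : ℕ} (h : d ≤ n) (A : Matrix (Fin n) (Fin n) ℝ) :
    Matrix (Fin d) (Fin n) ℝ :=
  A.submatrix (Fin.castLE h) id

/-- The `j`-th column of a `d × n` matrix, as a vector of `ℝ^d`. -/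
def column {d n : ℕ} (A : Matrix (Fin d) (Fin n) ℝ) (j : Fin n) : EuclideanSpace ℝ (Fin d) :=
  WithLp.toLp 2 fun i => A i j

/-! Let `X` have i.i.d. `N(0, S)` columns, so that the Wishart law is that of `X * Xᵀ`. Polar
decomposition writes `X` as the square root of `X * Xᵀ` times the first rows of some orthogonal `V`.
For fixed `X`, left invariance of Haar measure allows replacing `O` by `V * O`, which turns the
matrix under study into `X * O`. By Fubini, `O` may then be fixed instead, and `X * O` has the law
of `X` because the Gaussian law is rotation invariant. As `V` is only used for one `X` at a time, it
need not depend measurably on `X`. -/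

section SquareRoot

theorem isClosed_setOf_nonneg_matrix {d : ℕ} :
    IsClosed {A : Matrix (Fin d) (Fin d) ℝ | 0 ≤ A} := by
  have h : {A : Matrix (Fin d) (Fin d) ℝ | 0 ≤ A} =
      {A | Aᴴ = A} ∩ ⋂ x : Fin d → ℝ, {A | 0 ≤ star x ⬝ᵥ (A *ᵥ x)} := by
    ext A
    simp [Matrix.nonneg_iff_posSemidef, Matrix.posSemidef_iff_dotProduct_mulVec,
      Matrix.IsHermitian]
  rw [h]
  refine (isClosed_eq (by fun_prop) continuous_id).inter (isClosed_iInter fun x => ?_)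
  exact isClosed_le continuous_const (by fun_prop)

open scoped Matrix.Norms.L2Operator in
theorem continuousOn_matrix_sqrt {d : ℕ} :
    ContinuousOn (CFC.sqrt : Matrix (Fin d) (Fin d) ℝ → _) {A | 0 ≤ A} :=
  CFC.continuousOn_sqrt

/-- `CFC.sqrt` is continuous on the closed cone of positive semidefinite matrices and takes the
default value `0` off it. -/
theorem measurable_matrix_sqrt {d : ℕ} :
    Measurable (CFC.sqrt : Matrix (Fin d) (Fin d) ℝ → _) := by
  classical
  have h : (CFC.sqrt : Matrix (Fin d) (Fin d) ℝ → _) =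
      {A : Matrix (Fin d) (Fin d) ℝ | 0 ≤ A}.piecewise CFC.sqrt (fun _ => 0) := by
    ext1 A
    by_cases hA : 0 ≤ A
    · exact (if_pos (c := A ∈ {A : Matrix (Fin d) (Fin d) ℝ | 0 ≤ A}) hA).symm
    · rw [CFC.sqrt_of_not_nonneg hA]
      exact (if_neg (c := A ∈ {A : Matrix (Fin d) (Fin d) ℝ | 0 ≤ A}) hA).symm
  rw [h]
  exact continuousOn_matrix_sqrt.measurable_piecewise continuousOn_const
    isClosed_setOf_nonneg_matrix.measurableSet

end SquareRoot

section PolarDecomposition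

/-- Two linear maps with the same pointwise norm differ by a linear isometry of the codomain. -/
theorem exists_linearIsometry_comp_eq {E F : Type*} [AddCommGroup E] [Module ℝ E]
    [NormedAddCommGroup F] [InnerProductSpace ℝ F] [FiniteDimensional ℝ F]
    (f g : E →ₗ[ℝ] F) (h : ∀ u, ‖f u‖ = ‖g u‖) :
    ∃ L : F →ₗᵢ[ℝ] F, ∀ u, L (f u) = g u := by
  obtain ⟨s, hs⟩ := f.rangeRestrict.exists_rightInverse_of_surjective f.range_rangeRestrict
  have hs' : ∀ y, f (s y) = y := fun y => congrArg Subtype.val (LinearMap.congr_fun hs y)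
  -- The map `f u ↦ g u` on the range of `f`, made explicit by a linear section `s`. The choice of
  -- `s` is harmless: equal norms force equal kernels.
  let L₀ : LinearMap.range f →ₗᵢ[ℝ] F :=
    { toLinearMap := g ∘ₗ s
      norm_map' := fun y => by
        rw [LinearMap.comp_apply, ← h, hs']; rfl }
  refine ⟨L₀.extend, fun u => ?_⟩
  have h₁ : L₀.extend (f u) = g (s ⟨f u, u, rfl⟩) := L₀.extend_apply ⟨f u, u, rfl⟩
  rw [h₁, ← sub_eq_zero, ← norm_eq_zero, ← map_sub, ← h, map_sub, hs', sub_self, norm_zero]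

/-- Equal Gram matrices mean that `B *ᵥ u` and `C *ᵥ u` always have the same norm, so `B *ᵥ u ↦ C *ᵥ
u` extends to an isometry of the whole space. -/
theorem exists_orthogonal_mul_eq {d n : ℕ} (B C : Matrix (Fin n) (Fin d) ℝ)
    (h : Bᵀ * B = Cᵀ * C) :
    ∃ M : Matrix.orthogonalGroup (Fin n) ℝ, (M : Matrix (Fin n) (Fin n) ℝ) * B = C := by
  have hnorm : ∀ (D : Matrix (Fin n) (Fin d) ℝ) (u : Fin d → ℝ),
      ‖WithLp.toLp 2 (D *ᵥ u)‖ ^ 2 = u ⬝ᵥ ((Dᵀ * D) *ᵥ u) := fun D u => by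
    rw [EuclideanSpace.real_norm_sq_eq, ← Matrix.mulVec_mulVec, Matrix.dotProduct_mulVec,
      Matrix.vecMul_transpose]
    simp [dotProduct, sq]
  let T (D : Matrix (Fin n) (Fin d) ℝ) : (Fin d → ℝ) →ₗ[ℝ] EuclideanSpace ℝ (Fin n) :=
    (WithLp.linearEquiv 2 ℝ (Fin n → ℝ)).symm.toLinearMap ∘ₗ D.mulVecLin
  obtain ⟨L, hL⟩ := exists_linearIsometry_comp_eq (T B) (T C) fun u => by
    rw [← sq_eq_sq₀ (norm_nonneg _) (norm_nonneg _)]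
    exact (hnorm B u).trans ((congrArg (fun G => u ⬝ᵥ (G *ᵥ u)) h).trans (hnorm C u).symm)
  let M : Matrix (Fin n) (Fin n) ℝ := Matrix.of fun i j => L (EuclideanSpace.single j 1) i
  have hM : ∀ v, WithLp.toLp 2 (M *ᵥ v) = L (WithLp.toLp 2 v) := fun v => by
    have hv : WithLp.toLp 2 v = ∑ j, v j • EuclideanSpace.single j (1 : ℝ) := by
      ext i
      simp [Pi.single_apply]
    rw [hv, map_sum]
    ext i
    simp [M, Matrix.mulVec, dotProduct, mul_comm]
  have hMo : M ∈ Matrix.orthogonalGroup (Fin n) ℝ := by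
    rw [Matrix.mem_orthogonalGroup_iff']
    ext i j
    have := L.inner_map_map (EuclideanSpace.single i (1 : ℝ)) (EuclideanSpace.single j (1 : ℝ))
    simp only [PiLp.inner_apply] at this
    simpa [M, Matrix.mul_apply, Matrix.one_apply, mul_comm, Matrix.star_apply, Pi.single_apply,
      eq_comm] using this
  refine ⟨⟨M, hMo⟩, ?_⟩
  refine Matrix.ext_of_mulVec_single fun j => ?_
  have := hL (Pi.single j 1)
  apply WithLp.toLp_injective 2
  rw [← Matrix.mulVec_mulVec]
  exact (hM _).trans this

theorem firstRows_mul {d n : ℕ} (hdn : d ≤ n) (A B : Matrix (Fin n) (Fin n) ℝ) :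
    firstRows hdn (A * B) = firstRows hdn A * B := by
  ext i j
  simp [firstRows, Matrix.mul_apply]

/-- Polar decomposition of a rectangular matrix `X` with at least as many columns as rows. -/
theorem exists_eq_sqrt_mul_firstRows {d n : ℕ} (hdn : d ≤ n) (X : Matrix (Fin d) (Fin n) ℝ) :
    ∃ V : Matrix.orthogonalGroup (Fin n) ℝ,
      X = CFC.sqrt (X * Xᵀ) * firstRows hdn (V : Matrix (Fin n) (Fin n) ℝ) := by
  set A := CFC.sqrt (X * Xᵀ) with hA
  have hpos : 0 ≤ X * Xᵀ := by
    simpa using (Matrix.posSemidef_self_mul_conjTranspose X).nonneg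
  have hAA : A * A = X * Xᵀ := CFC.sqrt_mul_sqrt_self _ hpos
  have hAT : Aᵀ = A := by
    simpa using (Matrix.nonneg_iff_posSemidef.1 (CFC.sqrt_nonneg (X * Xᵀ))).isHermitian.eq
  let J : Matrix (Fin d) (Fin n) ℝ := firstRows hdn 1
  have hJ : J * Jᵀ = 1 := by
    ext i j
    simp [J, firstRows, Matrix.mul_apply, Matrix.one_apply, Fin.castLE_inj, eq_comm]
  -- Since `J * Jᵀ = 1`, padding `A` with zero columns to `A * J` keeps the product with its
  -- transpose equal to `X * Xᵀ`.
  obtain ⟨M, hM⟩ := exists_orthogonal_mul_eq (A * J)ᵀ Xᵀ (by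
    rw [Matrix.transpose_transpose, Matrix.transpose_transpose, Matrix.transpose_mul, hAT,
      Matrix.mul_assoc, ← Matrix.mul_assoc J, hJ, Matrix.one_mul, hAA])
  refine ⟨star M, ?_⟩
  have h := congrArg Matrix.transpose hM
  rw [Matrix.transpose_mul, Matrix.transpose_transpose, Matrix.transpose_transpose] at h
  rw [← h, Matrix.mul_assoc, ← firstRows_mul, Matrix.one_mul]
  simp [Matrix.star_eq_conjTranspose]

end PolarDecomposition

section Rotation

/-- The `d × n` matrix with prescribed columns. -/
def matrixOfColumns {d n : ℕ} (x : Fin n → EuclideanSpace ℝ (Fin d)) :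
    Matrix (Fin d) (Fin n) ℝ :=
  Matrix.of fun i j => x j i

theorem column_matrixOfColumns_mul {d n : ℕ} (x : Fin n → EuclideanSpace ℝ (Fin d))
    (O : Matrix (Fin n) (Fin n) ℝ) (k : Fin n) :
    column (matrixOfColumns x * O) k = ∑ j, O j k • x j := by
  ext i
  simp [column, matrixOfColumns, Matrix.mul_apply, mul_comm]

theorem scatterMatrix_eq_mul_transpose {d n : ℕ} (x : Fin n → EuclideanSpace ℝ (Fin d)) :
    scatterMatrix x = matrixOfColumns x * (matrixOfColumns x)ᵀ := by
  ext a b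
  simp [scatterMatrix, matrixOfColumns, Matrix.sum_apply, Matrix.vecMulVec_apply,
    Matrix.mul_apply]

/-- Orthonormality of the columns of `O` kills the cross terms. This is the invariance of the
exponent in the joint Gaussian characteristic function. -/
theorem sum_dotProduct_mulVec_rotate {d n : ℕ} (S : Matrix (Fin d) (Fin d) ℝ)
    (O : Matrix.orthogonalGroup (Fin n) ℝ) (t : Fin n → Fin d → ℝ) :
    ∑ j, (∑ k, (O : Matrix (Fin n) (Fin n) ℝ) j k • t k) ⬝ᵥ
        S *ᵥ (∑ k, (O : Matrix (Fin n) (Fin n) ℝ) j k • t k) =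
      ∑ k, t k ⬝ᵥ S *ᵥ t k := by
  have hO : ∀ k l, ∑ j, (O : Matrix (Fin n) (Fin n) ℝ) j k * (O : Matrix (Fin n) (Fin n) ℝ) j l =
      if k = l then 1 else 0 := fun k l => by
    have := congrFun (congrFun ((Matrix.mem_orthogonalGroup_iff' (Fin n) ℝ).1 O.2) k) l
    simpa [Matrix.mul_apply, Matrix.one_apply, Matrix.star_apply] using this
  calc _ = ∑ j, ∑ k, ∑ l, ((O : Matrix (Fin n) (Fin n) ℝ) j k *
            (O : Matrix (Fin n) (Fin n) ℝ) j l) * (t k ⬝ᵥ S *ᵥ t l) := by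
        refine Finset.sum_congr rfl fun j _ => ?_
        simp only [Matrix.mulVec_sum, Matrix.mulVec_smul, sum_dotProduct, dotProduct_sum,
          smul_dotProduct, dotProduct_smul, smul_eq_mul, mul_assoc, Finset.mul_sum]
        rw [Finset.sum_comm]
        exact Finset.sum_congr rfl fun k _ => Finset.sum_congr rfl fun l _ => by ring
    _ = ∑ k, ∑ l, (∑ j, (O : Matrix (Fin n) (Fin n) ℝ) j k *
            (O : Matrix (Fin n) (Fin n) ℝ) j l) * (t k ⬝ᵥ S *ᵥ t l) := by
        rw [Finset.sum_comm]
        refine Finset.sum_congr rfl fun k _ => ?_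
        rw [Finset.sum_comm]
        simp only [Finset.sum_mul]
    _ = _ := by simp [hO]

theorem measurable_column_matrixOfColumns_mul {d n : ℕ} :
    Measurable fun p : (Fin n → EuclideanSpace ℝ (Fin d)) × Matrix.orthogonalGroup (Fin n) ℝ =>
      fun k => column (matrixOfColumns p.1 * (p.2 : Matrix (Fin n) (Fin n) ℝ)) k := by
  simp only [column_matrixOfColumns_mul]
  refine measurable_pi_lambda _ fun k => Finset.measurable_sum _ fun j _ => ?_
  have h : Measurable fun p : (Fin n → EuclideanSpace ℝ (Fin d)) ×
      Matrix.orthogonalGroup (Fin n) ℝ => (p.2 : Matrix (Fin n) (Fin n) ℝ) j k :=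
    (measurable_pi_apply k).comp ((measurable_pi_apply j).comp
      (measurable_subtype_coe.comp measurable_snd))
  exact h.smul (by fun_prop)

/-- The law of a matrix with i.i.d. centred Gaussian columns is invariant under right
multiplication by orthogonal matrices. -/
theorem map_pi_multivariateGaussian_rotate {d n : ℕ} {S : Matrix (Fin d) (Fin d) ℝ}
    (hS : S.PosSemidef) (O : Matrix.orthogonalGroup (Fin n) ℝ) :
    (Measure.pi fun _ : Fin n => multivariateGaussian (0 : EuclideanSpace ℝ (Fin d)) S).map
        (fun x k => column (matrixOfColumns x * (O : Matrix (Fin n) (Fin n) ℝ)) k) =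
      Measure.pi fun _ : Fin n => multivariateGaussian (0 : EuclideanSpace ℝ (Fin d)) S := by
  set γ := Measure.pi fun _ : Fin n => multivariateGaussian (0 : EuclideanSpace ℝ (Fin d)) S
    with hγ
  have hT : Measurable fun (x : Fin n → EuclideanSpace ℝ (Fin d)) k =>
      column (matrixOfColumns x * (O : Matrix (Fin n) (Fin n) ℝ)) k :=
    measurable_column_matrixOfColumns_mul.comp (measurable_id.prodMk measurable_const)
  have := Measure.isFiniteMeasure_map γ fun (x : Fin n → EuclideanSpace ℝ (Fin d)) k =>
      column (matrixOfColumns x * (O : Matrix (Fin n) (Fin n) ℝ)) k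
  refine charFun_eq_pi_iff.1 fun t => ?_
  -- The adjoint rotation, moved from the sample `x` to the frequency `t`.
  let t' : PiLp 2 fun _ : Fin n => EuclideanSpace ℝ (Fin d) :=
    WithLp.toLp 2 fun j => ∑ k, (O : Matrix (Fin n) (Fin n) ℝ) j k • t k
  have h₁ : charFun ((γ.map fun x k =>
      column (matrixOfColumns x * (O : Matrix (Fin n) (Fin n) ℝ)) k).map (WithLp.toLp 2)) t =
      charFun (γ.map (WithLp.toLp 2)) t' := by
    rw [charFun_apply, charFun_apply, integral_map (by fun_prop) (by fun_prop),
      integral_map hT.aemeasurable (by fun_prop), integral_map (by fun_prop) (by fun_prop)]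
    congr with x
    congr 3
    simp only [PiLp.inner_apply (𝕜 := ℝ) (f := fun _ : Fin n => EuclideanSpace ℝ (Fin d)), t',
      column_matrixOfColumns_mul, sum_inner, inner_sum, inner_smul_left, inner_smul_right]
    rw [Finset.sum_comm]
    simp
  rw [h₁, charFun_pi]
  simp only [charFun_multivariateGaussian hS, ← Complex.exp_sum]
  congr 1
  have h₂ := sum_dotProduct_mulVec_rotate S O fun k => (t k).ofLp
  simp only [inner_zero_right, Complex.ofReal_zero, zero_mul, zero_sub, Finset.sum_neg_distrib,
    ← Finset.sum_div, ← Complex.ofReal_sum]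
  rw [← h₂]
  simp [t']

end Rotation

/-! ### Combining Haar and Gaussian invariance -/

theorem measurable_column_sqrt_mul_firstRows {d n : ℕ} (hdn : d ≤ n) :
    Measurable fun p : Matrix (Fin d) (Fin d) ℝ × Matrix.orthogonalGroup (Fin n) ℝ =>
      fun j => column (CFC.sqrt p.1 * firstRows hdn (p.2 : Matrix (Fin n) (Fin n) ℝ)) j := by
  refine measurable_pi_lambda _ fun j => ?_
  refine (WithLp.measurable_toLp 2 _).comp (measurable_pi_lambda _ fun i => ?_)
  simp only [Matrix.mul_apply]
  refine Finset.measurable_sum _ fun k _ => Measurable.mul ?_ ?_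
  · exact (measurable_pi_apply k).comp ((measurable_pi_apply i).comp
      (measurable_matrix_sqrt.comp measurable_fst))
  · exact (measurable_pi_apply j).comp ((measurable_pi_apply (Fin.castLE hdn k)).comp
      (measurable_subtype_coe.comp measurable_snd))

/-- Multiplying the square root of a Wishart matrix by the first rows of a Haar orthogonal
matrix gives a matrix with i.i.d. Gaussian columns. -/
theorem map_wishart_prod_haarOrthogonal {d n : ℕ} (hdn : d ≤ n)
    {S : Matrix (Fin d) (Fin d) ℝ} (hS : S.PosSemidef) :
    ((wishart n S).prod (haarOrthogonal n)).map (fun p j =>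
        column (CFC.sqrt p.1 * firstRows hdn (p.2 : Matrix (Fin n) (Fin n) ℝ)) j) =
      Measure.pi fun _ : Fin n => multivariateGaussian (0 : EuclideanSpace ℝ (Fin d)) S := by
  set γ := Measure.pi fun _ : Fin n => multivariateGaussian (0 : EuclideanSpace ℝ (Fin d)) S
    with hγ
  have hF := measurable_column_sqrt_mul_firstRows hdn
  have hG := measurable_column_matrixOfColumns_mul (d := d) (n := n)
  ext s hs
  have hw : (wishart n S).prod (haarOrthogonal n) =
      (γ.prod (haarOrthogonal n)).map (Prod.map scatterMatrix id) := by
    rw [← Measure.map_prod_map _ _ measurable_scatterMatrix measurable_id, Measure.map_id]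
    rfl
  have hsm : Measurable (Prod.map (scatterMatrix : (Fin n → EuclideanSpace ℝ (Fin d)) → _)
      (id : Matrix.orthogonalGroup (Fin n) ℝ → _)) :=
    measurable_scatterMatrix.prodMap measurable_id
  have hinv : ∀ x : Fin n → EuclideanSpace ℝ (Fin d),
      haarOrthogonal n {O | (fun j => column (CFC.sqrt (scatterMatrix x) *
        firstRows hdn (O : Matrix (Fin n) (Fin n) ℝ)) j) ∈ s} =
      haarOrthogonal n {O | (fun j => column (matrixOfColumns x *
        (O : Matrix (Fin n) (Fin n) ℝ)) j) ∈ s} := fun x => by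
    obtain ⟨V, hV⟩ := exists_eq_sqrt_mul_firstRows hdn (matrixOfColumns x)
    -- Translating by `V` absorbs the polar factor of `x`.
    rw [← measure_preimage_mul (haarOrthogonal n) V]
    congr 1
    ext O
    simp only [Set.mem_preimage, Set.mem_ofPred_eq]
    rw [Submonoid.coe_mul, firstRows_mul, ← Matrix.mul_assoc, scatterMatrix_eq_mul_transpose, ← hV]
  calc _ = (γ.prod (haarOrthogonal n)) ((fun p => fun j => column (CFC.sqrt (scatterMatrix p.1) *
          firstRows hdn (p.2 : Matrix (Fin n) (Fin n) ℝ)) j) ⁻¹' s) := by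
        rw [Measure.map_apply hF hs, hw, Measure.map_apply hsm (hF hs)]
        rfl
    _ = ∫⁻ x, haarOrthogonal n {O | (fun j => column (CFC.sqrt (scatterMatrix x) *
          firstRows hdn (O : Matrix (Fin n) (Fin n) ℝ)) j) ∈ s} ∂γ :=
        Measure.prod_apply ((hF.comp hsm) hs)
    _ = ∫⁻ x, haarOrthogonal n {O | (fun j => column (matrixOfColumns x *
          (O : Matrix (Fin n) (Fin n) ℝ)) j) ∈ s} ∂γ := lintegral_congr hinv
    _ = (γ.prod (haarOrthogonal n)) ((fun p => fun j => column (matrixOfColumns p.1 *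
          (p.2 : Matrix (Fin n) (Fin n) ℝ)) j) ⁻¹' s) := (Measure.prod_apply (hG hs)).symm
    _ = ∫⁻ O, γ ((fun x j => column (matrixOfColumns x *
          (O : Matrix (Fin n) (Fin n) ℝ)) j) ⁻¹' s) ∂haarOrthogonal n :=
        Measure.prod_apply_symm (hG hs)
    _ = ∫⁻ _, γ s ∂haarOrthogonal n := lintegral_congr fun O => by
        exact (Measure.map_apply (hG.comp (measurable_id.prodMk measurable_const)) hs).symm.trans
          (congrArg (· s) (map_pi_multivariateGaussian_rotate hS O))
    _ = γ s := by simp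

theorem lemma6p8 {Ω : Type*} [MeasurableSpace Ω] (P : Measure Ω) [IsProbabilityMeasure P]
    {d n : ℕ} (hdn : d ≤ n)
    (S : Matrix (Fin d) (Fin d) ℝ) (hS : S.PosDef)
    (W : Ω → Matrix (Fin d) (Fin d) ℝ) (hW : HasLaw W (wishart n S) P)
    (Q : Ω → Matrix.orthogonalGroup (Fin n) ℝ) (hQ : HasLaw Q (haarOrthogonal n) P)
    (hWQ : IndepFun W Q P) :
    iIndepFun (fun (j : Fin n) (ω : Ω) =>
        column (CFC.sqrt (W ω) * firstRows hdn (Q ω : Matrix (Fin n) (Fin n) ℝ)) j) P ∧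
      ∀ j : Fin n, HasLaw
        (fun ω => column (CFC.sqrt (W ω) * firstRows hdn (Q ω : Matrix (Fin n) (Fin n) ℝ)) j)
        (multivariateGaussian (0 : EuclideanSpace ℝ (Fin d)) S) P := by
  have hWQ' : HasLaw (fun ω => (W ω, Q ω)) ((wishart n S).prod (haarOrthogonal n)) P :=
    (indepFun_iff_hasLaw_prodMk_prod hW hQ).1 hWQ
  have hF : HasLaw (fun p : Matrix (Fin d) (Fin d) ℝ × Matrix.orthogonalGroup (Fin n) ℝ =>
      fun j => column (CFC.sqrt p.1 * firstRows hdn (p.2 : Matrix (Fin n) (Fin n) ℝ)) j)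
      (Measure.pi fun _ : Fin n => multivariateGaussian (0 : EuclideanSpace ℝ (Fin d)) S)
      ((wishart n S).prod (haarOrthogonal n)) :=
    ⟨(measurable_column_sqrt_mul_firstRows hdn).aemeasurable,
      map_wishart_prod_haarOrthogonal hdn hS.posSemidef⟩
  have hY := hF.comp hWQ'
  have hcol : ∀ j : Fin n, HasLaw
      (fun ω => column (CFC.sqrt (W ω) * firstRows hdn (Q ω : Matrix (Fin n) (Fin n) ℝ)) j)
      (multivariateGaussian (0 : EuclideanSpace ℝ (Fin d)) S) P := fun j =>
    (measurePreserving_eval _ j).hasLaw.comp hY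
  exact ⟨(iIndepFun_iff_hasLaw_pi_pi hcol).2 hY, hcol⟩
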